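/- Let $k\ge 3$ and $r\ge 1$ be integers, and let $G$ be a finite simple graph whose vertex set is a disjoint union $S\,\dot\cup\,T$ with $|T|\ge 5k^2\sqrt r$, such that every vertex $v$ of $G$ has degree $d(v)\ge |V(G)|-k\sqrt r$. Let $R$ be any set of at most $k^2r$ edges of $G$, each having both endpoints in $S$, and let $G\setminus R$ be the graph on $V(G)$ obtained from $G$ by deleting the edges in $R$. Then $G\setminus R$ contains a collection of pairwise vertex-disjoint cliques, each on exactly $k$ vertices, such that every vertex of $S$ and all but at most $k-1$ vertices of $T$ belong to some clique of the collection. -/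

import Mathlib

/-! Put `m = ⌊k√r⌋`. Each vertex has at most `m` non-neighbours in `G`, itself included, and `|R| <
(m + 1)²`. Too few edges are deleted to spoil `S`: the complement of `G \ R` is `2m`-degenerate
there, so greedy colouring splits `S` into `2m + 1` cliques. Cut each into `k`-cliques and complete
the remainder with at most `k - 1` vertices of `T`, whose edges are untouched by `R`.

Since `|T| ≥ 5km`, at least `2mk` vertices of `T` remain. Drop fewer than `k` of them to leave `qk`
vertices with `q ≥ 2m`. Insert these one by one into `q` cliques of size at most `k`, a weak
Hajnal–Szemerédi argument (`exists_boundedColoring_insert`) needing at most one swap per vertex; in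
the end all `q` cliques are full. -/

/-- The vertices of `U` can be partitioned into `k`-cliques of `G`. -/
def CliqueTileable {V : Type*} [DecidableEq V] (G : SimpleGraph V) (k : ℕ) (U : Finset V) : Prop :=
  ∃ F : Finset (Finset V), (∀ C ∈ F, G.IsNClique k C) ∧
    (∀ C ∈ F, ∀ D ∈ F, C ≠ D → Disjoint C D) ∧ F.biUnion id = U

section Tiling

variable {V : Type*} [DecidableEq V] {G : SimpleGraph V} {k m : ℕ}

theorem CliqueTileable.empty : CliqueTileable G k ∅ :=
  ⟨∅, by simp, by simp, by simp⟩

theorem CliqueTileable.of_isNClique {C : Finset V} (h : G.IsNClique k C) :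
    CliqueTileable G k C :=
  ⟨{C}, by simpa using h, by simp, by simp⟩

theorem CliqueTileable.union {U W : Finset V} (hU : CliqueTileable G k U)
    (hW : CliqueTileable G k W) (hUW : Disjoint U W) : CliqueTileable G k (U ∪ W) := by
  obtain ⟨F, hF, hFd, rfl⟩ := hU
  obtain ⟨F', hF', hFd', rfl⟩ := hW
  have key : ∀ C ∈ F, ∀ D ∈ F', Disjoint C D := fun C hC D hD =>
    hUW.mono (Finset.subset_biUnion_of_mem id hC) (Finset.subset_biUnion_of_mem id hD)
  refine ⟨F ∪ F', ?_, ?_, Finset.union_biUnion⟩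
  · intro C hC
    rcases Finset.mem_union.1 hC with h | h
    exacts [hF C h, hF' C h]
  · intro C hC D hD hne
    rcases Finset.mem_union.1 hC with h | h <;> rcases Finset.mem_union.1 hD with h' | h'
    exacts [hFd C h D h' hne, key C h D h', (key D h' C h).symm, hFd' C h D h' hne]

/-! ### Covering `S`: greedy clique colouring and completion -/

open Classical in
/-- A graph whose complement is `(D - 1)`-degenerate on `A` admits a partition of `A` into
`D` cliques. -/
theorem exists_cliqueColoring {D : ℕ} (A : Finset V)
    (h : ∀ B ⊆ A, B.Nonempty → ∃ v ∈ B, (B.filter fun w => w ≠ v ∧ ¬ G.Adj v w).card < D) :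
    ∃ f : V → ℕ, (∀ v ∈ A, f v < D) ∧
      ∀ v ∈ A, ∀ w ∈ A, v ≠ w → f v = f w → G.Adj v w := by
  induction A using Finset.strongInduction with
  | H A ih =>
    rcases A.eq_empty_or_nonempty with rfl | hA
    · exact ⟨fun _ => 0, by simp, by simp⟩
    obtain ⟨v, hv, hlt⟩ := h A subset_rfl hA
    obtain ⟨f, hf, hfc⟩ := ih (A.erase v) (Finset.erase_ssubset hv)
      fun B hB => h B (hB.trans (Finset.erase_subset _ _))
    obtain ⟨c, hc, hcn⟩ : ∃ c ∈ Finset.range D,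
        c ∉ (A.filter fun w => w ≠ v ∧ ¬ G.Adj v w).image f := by
      apply Finset.exists_mem_notMem_of_card_lt_card
      rw [Finset.card_range]
      exact Finset.card_image_le.trans_lt hlt
    have adj : ∀ w ∈ A, w ≠ v → f w = c → G.Adj v w := by
      intro w hw hwv hfw
      by_contra hn
      exact hcn (Finset.mem_image.2 ⟨w, Finset.mem_filter.2 ⟨hw, hwv, hn⟩, hfw⟩)
    refine ⟨Function.update f v c, ?_, ?_⟩
    · intro w hw
      by_cases hwv : w = v
      · subst hwv; simpa using hc
      · simpa [hwv] using hf w (Finset.mem_erase.2 ⟨hwv, hw⟩)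
    · intro x hx y hy hxy hfxy
      by_cases hxv : x = v
      · subst hxv
        rw [Function.update_self, Function.update_of_ne hxy.symm] at hfxy
        exact adj y hy hxy.symm hfxy.symm
      by_cases hyv : y = v
      · subst hyv
        rw [Function.update_self, Function.update_of_ne hxy] at hfxy
        exact (adj x hx hxy hfxy).symm
      rw [Function.update_of_ne hxv, Function.update_of_ne hyv] at hfxy
      exact hfc x (Finset.mem_erase.2 ⟨hxv, hx⟩) y (Finset.mem_erase.2 ⟨hyv, hy⟩) hxy hfxy

open Classical in
/-- A clique on at most `k` vertices extends to a `k`-clique inside a large set whose vertices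
are adjacent to almost everything. -/
theorem exists_isNClique_extension {X : Finset V} (hX : (k - 1) * m < X.card)
    (hm : ∀ v, (X.filter fun x => ¬ G.Adj v x).card ≤ m) (C : Finset V)
    (hC : G.IsClique (C : Set V)) (hCk : C.card ≤ k) :
    ∃ E ⊆ X, Disjoint C E ∧ G.IsNClique k (C ∪ E) := by
  induction hj : k - C.card generalizing C with
  | zero =>
    refine ⟨∅, by simp, by simp, ?_⟩
    rw [Finset.union_empty]
    exact ⟨hC, by omega⟩
  | succ j ih =>
    obtain ⟨x, hx, hxn⟩ : ∃ x ∈ X, x ∉ C.biUnion fun v => X.filter fun x => ¬ G.Adj v x := by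
      apply Finset.exists_mem_notMem_of_card_lt_card
      calc _ ≤ C.card * m := Finset.card_biUnion_le_card_mul _ _ _ fun v _ => hm v
        _ ≤ (k - 1) * m := Nat.mul_le_mul_right _ (by omega)
        _ < _ := hX
    have adj : ∀ v ∈ C, G.Adj v x := by
      intro v hv
      by_contra hn
      exact hxn (Finset.mem_biUnion.2 ⟨v, hv, Finset.mem_filter.2 ⟨hx, hn⟩⟩)
    have hxC : x ∉ C := fun h => G.loopless.irrefl x (adj x h)
    have hcard : (insert x C).card = C.card + 1 := Finset.card_insert_of_notMem hxC
    obtain ⟨E, hE, hdE, hcl⟩ := ih (insert x C)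
      (by
        rw [Finset.coe_insert]
        exact hC.insert fun v hv _ => (adj v hv).symm) (by omega) (by omega)
    rw [Finset.disjoint_insert_left] at hdE
    refine ⟨insert x E, Finset.insert_subset hx hE, ?_, ?_⟩
    · rw [Finset.disjoint_insert_right]
      exact ⟨hxC, hdE.2⟩
    · rwa [Finset.union_insert, ← Finset.insert_union]

open Classical in
/-- Any clique can be tiled by `k`-cliques after adding at most `k - 1` vertices of `X`. -/
theorem exists_tileable_of_isClique (hk : 1 ≤ k) {X : Finset V} (hX : (k - 1) * m < X.card)
    (hm : ∀ v, (X.filter fun x => ¬ G.Adj v x).card ≤ m) (C : Finset V)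
    (hC : G.IsClique (C : Set V)) (hCX : Disjoint C X) :
    ∃ E ⊆ X, E.card ≤ k - 1 ∧ CliqueTileable G k (C ∪ E) := by
  induction C using Finset.strongInduction with
  | H C ih =>
    rcases C.eq_empty_or_nonempty with rfl | hne
    · exact ⟨∅, by simp, by simp, by simpa using CliqueTileable.empty⟩
    rcases le_or_gt k C.card with hkC | hkC
    · obtain ⟨C₀, hC₀, hcard⟩ := Finset.exists_subset_card_eq hkC
      have hne₀ : C₀.Nonempty := Finset.card_pos.1 (by omega)
      obtain ⟨E, hE, hEc, ht⟩ := ih (C \ C₀) (Finset.sdiff_ssubset hC₀ hne₀)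
        (hC.subset (by exact_mod_cast Finset.sdiff_subset)) (hCX.mono_left Finset.sdiff_subset)
      refine ⟨E, hE, hEc, ?_⟩
      have h₀ : CliqueTileable G k C₀ :=
        .of_isNClique ⟨hC.subset (by exact_mod_cast hC₀), hcard⟩
      have := h₀.union ht (by
        rw [Finset.disjoint_union_right]
        exact ⟨Finset.disjoint_sdiff, hCX.mono hC₀ hE⟩)
      rwa [← Finset.union_assoc, Finset.union_sdiff_of_subset hC₀] at this
    · obtain ⟨E, hE, hd, hcl⟩ := exists_isNClique_extension hX hm C hC hkC.le
      refine ⟨E, hE, ?_, .of_isNClique hcl⟩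
      have h1 := hcl.card_eq
      have h2 := hne.card_pos
      rw [Finset.card_union_of_disjoint hd] at h1
      omega

open Classical in
/-- A set partitioned into `D` cliques can be tiled by `k`-cliques after adding at most
`D * (k - 1)` vertices of `X`. -/
theorem exists_tileable_of_coloring (hk : 1 ≤ k) {X : Finset V}
    (hm : ∀ v, (X.filter fun x => ¬ G.Adj v x).card ≤ m) (f : V → ℕ) (D : ℕ) (S : Finset V)
    (hX : (k - 1) * m + D * (k - 1) < X.card) (hSX : Disjoint S X) (hf : ∀ v ∈ S, f v < D)
    (hfc : ∀ v ∈ S, ∀ w ∈ S, v ≠ w → f v = f w → G.Adj v w) :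
    ∃ E ⊆ X, E.card ≤ D * (k - 1) ∧ CliqueTileable G k (S ∪ E) := by
  induction D generalizing S with
  | zero =>
    have : S = ∅ := Finset.eq_empty_of_forall_notMem fun v hv => by simpa using hf v hv
    exact ⟨∅, by simp, by simp, by simpa [this] using CliqueTileable.empty⟩
  | succ D ih =>
    rw [Nat.succ_mul] at hX
    obtain ⟨E, hE, hEc, ht⟩ := ih (S.filter fun v => f v < D) (by omega)
      (hSX.mono_left (Finset.filter_subset _ _)) (fun v hv => (Finset.mem_filter.1 hv).2)
      (fun v hv w hw => hfc v (Finset.mem_filter.1 hv).1 w (Finset.mem_filter.1 hw).1)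
    -- At most `D * (k - 1)` vertices are spent so far, so `X \ E` keeps more than `(k - 1) * m`,
    -- enough for the last colour class.
    have hcard := Finset.card_sdiff_add_card_eq_card hE
    obtain ⟨E', hE', hEc', ht'⟩ := exists_tileable_of_isClique (G := G) (m := m) hk
      (X := X \ E) (by omega)
      (fun v => (Finset.card_le_card (Finset.filter_subset_filter _ Finset.sdiff_subset)).trans
        (hm v))
      (S.filter fun v => ¬ f v < D)
      (by
        intro v hv w hw hvw
        simp only [Finset.coe_filter, Set.mem_ofPred_eq] at hv hw
        have h1 := hf v hv.1
        have h2 := hf w hw.1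
        exact hfc v hv.1 w hw.1 hvw (by omega))
      (hSX.mono (Finset.filter_subset _ _) Finset.sdiff_subset)
    refine ⟨E ∪ E', Finset.union_subset hE (hE'.trans Finset.sdiff_subset), ?_, ?_⟩
    · have := Finset.card_union_le E E'
      rw [Nat.succ_mul]
      omega
    · have := ht.union ht' (by
        rw [Finset.disjoint_union_left, Finset.disjoint_union_right, Finset.disjoint_union_right]
        refine ⟨⟨Finset.disjoint_filter_filter_not _ _ _, ?_⟩, ?_, ?_⟩
        · exact hSX.mono (Finset.filter_subset _ _) (hE'.trans Finset.sdiff_subset)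
        · exact (hSX.mono (Finset.filter_subset _ _) hE).symm
        · exact Finset.disjoint_sdiff.mono_right hE')
      rwa [Finset.union_union_union_comm, Finset.filter_union_filter_not_eq] at this

/-! ### Equitable clique colouring of the rest of `T` -/

open Classical in
/-- One step of the equitable colouring: a colouring of `W` by cliques of size at most `k`
extends to one further vertex. -/
theorem exists_boundedColoring_insert {q : ℕ} (hm : 1 ≤ m) (hq : 2 * m ≤ q) {W : Finset V} {v : V}
    (hv : v ∉ W) (hW : W.card < q * k)
    (hdeg : ∀ v, (W.filter fun x => ¬ G.Adj v x).card ≤ m) (f : V → Fin q)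
    (hfc : ∀ x ∈ W, ∀ y ∈ W, x ≠ y → f x = f y → G.Adj x y)
    (hfk : ∀ b, (W.filter fun x => f x = b).card ≤ k) :
    ∃ g : V → Fin q, (∀ x ∈ insert v W, ∀ y ∈ insert v W, x ≠ y → g x = g y → G.Adj x y) ∧
      ∀ b, ((insert v W).filter fun x => g x = b).card ≤ k := by
  have ne_of_mem : ∀ x ∈ W, x ≠ v := fun x hx h => hv (h ▸ hx)
  -- a vertex may be coloured directly if it sees all of a non-full class
  have direct : ∀ b, (∀ x ∈ W, f x = b → G.Adj v x) → (W.filter fun x => f x = b).card < k →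
      ∃ g : V → Fin q, (∀ x ∈ insert v W, ∀ y ∈ insert v W, x ≠ y → g x = g y → G.Adj x y) ∧
        ∀ b, ((insert v W).filter fun x => g x = b).card ≤ k := by
    intro b hb hbk
    refine ⟨Function.update f v b, ?_, ?_⟩
    · intro x hx y hy hxy hg
      rw [Finset.mem_insert] at hx hy
      rcases hx with rfl | hx <;> rcases hy with rfl | hy
      · exact absurd rfl hxy
      · rw [Function.update_self, Function.update_of_ne hxy.symm] at hg
        exact hb y hy hg.symm
      · rw [Function.update_self, Function.update_of_ne hxy] at hg
        exact (hb x hx hg).symm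
      · rw [Function.update_of_ne (ne_of_mem x hx), Function.update_of_ne (ne_of_mem y hy)] at hg
        exact hfc x hx y hy hxy hg
    · intro c
      by_cases hc : c = b
      · subst hc
        refine (Finset.card_le_card (t := insert v (W.filter fun x => f x = c)) ?_).trans
          ((Finset.card_insert_le _ _).trans hbk)
        intro x hx
        simp only [Finset.mem_filter, Finset.mem_insert] at hx ⊢
        rcases hx with ⟨rfl | hx, hg⟩
        · exact Or.inl rfl
        · rw [Function.update_of_ne (ne_of_mem x hx)] at hg
          exact Or.inr ⟨hx, hg⟩
      · refine (Finset.card_le_card ?_).trans (hfk c)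
        intro x hx
        simp only [Finset.mem_filter, Finset.mem_insert] at hx ⊢
        rcases hx with ⟨rfl | hx, hg⟩
        · rw [Function.update_self] at hg
          exact absurd hg.symm hc
        · rw [Function.update_of_ne (ne_of_mem x hx)] at hg
          exact ⟨hx, hg⟩
  obtain ⟨a, ha⟩ : ∃ a, (W.filter fun x => f x = a).card < k := by
    by_contra! hcon
    have h1 := Finset.card_eq_sum_card_fiberwise (f := f) (s := W) (t := Finset.univ)
      (fun _ _ => Finset.mem_coe.2 (Finset.mem_univ _))
    have h2 : ∑ _b : Fin q, k ≤ ∑ b : Fin q, (W.filter fun x => f x = b).card :=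
      Finset.sum_le_sum fun b _ => hcon b
    simp only [Finset.sum_const, Finset.card_univ, Fintype.card_fin, smul_eq_mul] at h2
    omega
  by_cases hdir : ∃ b, (∀ x ∈ W, f x = b → G.Adj v x) ∧ (W.filter fun x => f x = b).card < k
  · obtain ⟨b, hb, hbk⟩ := hdir
    exact direct b hb hbk
  push Not at hdir
  -- otherwise put `v` into a full class `b`, one of whose vertices moves to the class `a`
  set N₁ : Finset (Fin q) := (W.filter fun x => ¬ G.Adj v x).image f with hN₁
  set Y : Finset V := (W.filter fun x => f x = a).biUnion fun u => W.filter fun x => ¬ G.Adj u x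
    with hY
  set N₂ : Finset (Fin q) := Finset.univ.filter fun b =>
    (∀ x ∈ W, f x = b → G.Adj v x) ∧ ∀ x ∈ W, f x = b → x ∈ Y with hN₂
  -- `N₁` holds the classes that `v` does not fully see, `N₂` those it sees but from which no vertex
  -- can move to `a`. Together they number fewer than `2 * m ≤ q`, so some class `b` avoids both.
  have hN₁c : N₁.card ≤ m := Finset.card_image_le.trans (hdeg v)
  have hN₂c : N₂.card < m := by
    have h1 : Y.card ≤ (k - 1) * m :=
      (Finset.card_biUnion_le_card_mul _ _ _ fun u _ => hdeg u).trans
        (Nat.mul_le_mul_right _ (by omega))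
    -- By `hdir` every class in `N₂` is full, so it puts `k` vertices into `Y`.
    have h2 : N₂.card * k ≤ Y.card := by
      have h3 : ∑ _b ∈ N₂, k ≤ ∑ b ∈ N₂, (Y.filter fun x => f x = b).card := by
        refine Finset.sum_le_sum fun b hb => ?_
        have hb' := (Finset.mem_filter.1 hb).2
        refine (hdir b hb'.1).trans (Finset.card_le_card fun x hx => ?_)
        rw [Finset.mem_filter] at hx ⊢
        exact ⟨hb'.2 x hx.1 hx.2, hx.2⟩
      rw [Finset.sum_const, smul_eq_mul] at h3
      rw [Finset.sum_card_fiberwise_eq_card_filter] at h3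
      exact h3.trans (Finset.card_filter_le _ _)
    by_contra! hcon
    have h4 : m * k ≤ (k - 1) * m := (Nat.mul_le_mul_right k hcon).trans (h2.trans h1)
    rw [mul_comm] at h4
    have := Nat.le_of_mul_le_mul_right h4 hm
    omega
  obtain ⟨b, -, hb⟩ : ∃ b ∈ (Finset.univ : Finset (Fin q)), b ∉ N₁ ∪ N₂ := by
    apply Finset.exists_mem_notMem_of_card_lt_card
    rw [Finset.card_univ, Fintype.card_fin]
    have := Finset.card_union_le N₁ N₂
    omega
  rw [Finset.mem_union, not_or] at hb
  have hvb : ∀ x ∈ W, f x = b → G.Adj v x := by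
    intro x hx hfx
    by_contra hn
    exact hb.1 (Finset.mem_image.2 ⟨x, Finset.mem_filter.2 ⟨hx, hn⟩, hfx⟩)
  obtain ⟨w, hw, hwb, hwY⟩ : ∃ w ∈ W, f w = b ∧ w ∉ Y := by
    by_contra! hcon
    exact hb.2 (Finset.mem_filter.2 ⟨Finset.mem_univ _, hvb, hcon⟩)
  have hwa : ∀ u ∈ W, f u = a → G.Adj u w := by
    intro u hu hfu
    by_contra hn
    exact hwY (Finset.mem_biUnion.2 ⟨u, Finset.mem_filter.2 ⟨hu, hfu⟩,
      Finset.mem_filter.2 ⟨hw, hn⟩⟩)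
  have hab : b ≠ a := by
    rintro rfl
    exact absurd (hdir b hvb) (by omega)
  have hwv : w ≠ v := ne_of_mem w hw
  set g := Function.update (Function.update f w a) v b with hg
  have gv : g v = b := Function.update_self _ _ _
  have gw : g w = a := by rw [hg, Function.update_of_ne hwv, Function.update_self]
  have gx : ∀ x ∈ W, x ≠ w → g x = f x := fun x hx hxw => by
    rw [hg, Function.update_of_ne (ne_of_mem x hx), Function.update_of_ne hxw]
  refine ⟨g, ?_, ?_⟩
  · have hvx : ∀ x ∈ W, g x = b → G.Adj v x := by
      intro x hx hgx
      by_cases hxw : x = w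
      · subst hxw
        exact absurd (hgx.symm.trans gw) hab
      · exact hvb x hx ((gx x hx hxw).symm.trans hgx)
    have hwx : ∀ x ∈ W, x ≠ w → g x = a → G.Adj x w := fun x hx hxw hgx =>
      hwa x hx ((gx x hx hxw).symm.trans hgx)
    intro x hx y hy hxy hgxy
    rw [Finset.mem_insert] at hx hy
    rcases hx with rfl | hx <;> rcases hy with rfl | hy
    · exact absurd rfl hxy
    · exact hvx y hy (hgxy.symm.trans gv)
    · exact (hvx x hx (hgxy.trans gv)).symm
    · by_cases hxw : x = w
      · subst hxw
        exact (hwx y hy hxy.symm (hgxy.symm.trans gw)).symm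
      by_cases hyw : y = w
      · subst hyw
        exact hwx x hx hxy (hgxy.trans gw)
      rw [gx x hx hxw, gx y hy hyw] at hgxy
      exact hfc x hx y hy hxy hgxy
  · intro c
    by_cases hcb : c = b
    · subst hcb
      have hmem : w ∈ W.filter fun x => f x = c := Finset.mem_filter.2 ⟨hw, hwb⟩
      refine (Finset.card_le_card
        (t := insert v ((W.filter fun x => f x = c).erase w)) ?_).trans
        ((Finset.card_insert_le _ _).trans ?_)
      · intro x hx
        simp only [Finset.mem_filter, Finset.mem_insert, Finset.mem_erase] at hx ⊢
        rcases hx with ⟨rfl | hx, hgx⟩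
        · exact Or.inl rfl
        · have hxw : x ≠ w := by
            rintro rfl
            exact hab (hgx.symm.trans gw)
          exact Or.inr ⟨hxw, hx, (gx x hx hxw).symm.trans hgx⟩
      · rw [Finset.card_erase_add_one hmem]
        exact hfk c
    · have hcv : ∀ x ∈ insert v W, g x = c → x ∈ W := by
        intro x hx hgx
        rcases Finset.mem_insert.1 hx with rfl | hx
        · exact absurd (hgx.symm.trans gv) hcb
        · exact hx
      by_cases hca : c = a
      · subst hca
        refine (Finset.card_le_card (t := insert w (W.filter fun x => f x = c)) ?_).trans
          ((Finset.card_insert_le _ _).trans ha)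
        intro x hx
        rw [Finset.mem_filter] at hx
        have hxW := hcv x hx.1 hx.2
        rw [Finset.mem_insert, Finset.mem_filter]
        by_cases hxw : x = w
        · exact Or.inl hxw
        · exact Or.inr ⟨hxW, (gx x hxW hxw).symm.trans hx.2⟩
      · refine (Finset.card_le_card ?_).trans (hfk c)
        intro x hx
        rw [Finset.mem_filter] at hx
        have hxW := hcv x hx.1 hx.2
        have hxw : x ≠ w := by
          rintro rfl
          exact hca (hx.2.symm.trans gw)
        exact Finset.mem_filter.2 ⟨hxW, (gx x hxW hxw).symm.trans hx.2⟩

open Classical in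
/-- If every vertex has at most `m` non-neighbours (itself included) in a set of `q * k` vertices
with `q ≥ 2 * m`, then this set can be tiled by `k`-cliques. -/
theorem tileable_of_card_eq {q : ℕ} (hm : 1 ≤ m) (hq : 2 * m ≤ q) {T : Finset V}
    (hT : T.card = q * k) (hdeg : ∀ v, (T.filter fun x => ¬ G.Adj v x).card ≤ m) :
    CliqueTileable G k T := by
  have hcol : ∀ W ⊆ T, ∃ f : V → Fin q,
      (∀ x ∈ W, ∀ y ∈ W, x ≠ y → f x = f y → G.Adj x y) ∧
      ∀ b, (W.filter fun x => f x = b).card ≤ k := by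
    intro W
    induction W using Finset.induction_on with
    | empty => exact fun _ => ⟨fun _ => ⟨0, by omega⟩, by simp, by simp⟩
    | insert v W hv ih =>
      intro hW
      obtain ⟨f, hfc, hfk⟩ := ih ((Finset.subset_insert _ _).trans hW)
      refine exists_boundedColoring_insert hm hq hv ?_ (fun u => ?_) f hfc hfk
      · have := Finset.card_le_card hW
        rw [Finset.card_insert_of_notMem hv] at this
        omega
      · exact (Finset.card_le_card (Finset.filter_subset_filter _
          ((Finset.subset_insert _ _).trans hW))).trans (hdeg u)
  obtain ⟨f, hfc, hfk⟩ := hcol T subset_rfl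
  -- `q` classes of size at most `k` cover `q * k` vertices, so each is full.
  have hcard : ∀ b, (T.filter fun x => f x = b).card = k := by
    have h1 := Finset.card_eq_sum_card_fiberwise (f := f) (s := T) (t := Finset.univ)
      (fun _ _ => Finset.mem_coe.2 (Finset.mem_univ _))
    have h2 : ∑ b : Fin q, (T.filter fun x => f x = b).card = ∑ _b : Fin q, k := by
      rw [← h1, hT]
      simp
    exact fun b => (Finset.sum_eq_sum_iff_of_le fun b _ => hfk b).1 h2 b (Finset.mem_univ _)
  refine ⟨Finset.univ.image fun b => T.filter fun x => f x = b, ?_, ?_, ?_⟩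
  · intro C hC
    obtain ⟨b, -, rfl⟩ := Finset.mem_image.1 hC
    refine ⟨fun x hx y hy hxy => ?_, hcard b⟩
    rw [Finset.mem_coe, Finset.mem_filter] at hx hy
    exact hfc x hx.1 y hy.1 hxy (hx.2.trans hy.2.symm)
  · intro C hC D hD hne
    obtain ⟨b, -, rfl⟩ := Finset.mem_image.1 hC
    obtain ⟨c, -, rfl⟩ := Finset.mem_image.1 hD
    rw [Finset.disjoint_left]
    intro x hx hx'
    rw [Finset.mem_filter] at hx hx'
    exact hne (by rw [← hx.2, ← hx'.2])
  · ext x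
    simp

end Tiling

/-! ### Degeneracy after edge deletion -/

open Classical in
/-- Deleting fewer than `(m + 1) ^ 2` edges from a graph in which every vertex has at most `m`
non-neighbours (itself included) leaves a graph with `2 * m`-degenerate complement. -/
theorem exists_card_nonadj_deleteEdges_lt {V : Type*} [Fintype V] {G : SimpleGraph V} {m : ℕ}
    (hdeg : ∀ v, (Finset.univ.filter fun x => ¬ G.Adj v x).card ≤ m)
    (R : Finset (Sym2 V)) (hR : R.card < (m + 1) ^ 2) (B : Finset V) (hB : B.Nonempty) :
    ∃ v ∈ B, (B.filter fun w => w ≠ v ∧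
      ¬ (G.deleteEdges (R : Set (Sym2 V))).Adj v w).card < 2 * m + 1 := by
  by_contra! hcon
  obtain ⟨v₀, hv₀⟩ := hB
  have hBc : 2 * m + 2 ≤ B.card := by
    have h1 := (hcon v₀ hv₀).trans (Finset.card_le_card (t := B.erase v₀) (fun w hw => by
      rw [Finset.mem_filter] at hw
      exact Finset.mem_erase.2 ⟨hw.2.1, hw.1⟩))
    rw [Finset.card_erase_of_mem hv₀] at h1
    omega
  set H := SimpleGraph.fromEdgeSet (R : Set (Sym2 V)) with hH
  -- At most `m` of the `2 * m + 1` non-neighbours come from `G`; the rest come from `R`. Summing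
  -- over `B` gives `2 * (m + 1) ^ 2 ≤ 2 * R.card`.
  have hHdeg : ∀ v ∈ B, m + 1 ≤ H.degree v := by
    intro v hv
    have h1 := hcon v hv
    have h2 := Finset.card_le_card
      (s := B.filter fun w => w ≠ v ∧ ¬ (G.deleteEdges (R : Set (Sym2 V))).Adj v w)
      (t := (Finset.univ.filter fun x => ¬ G.Adj v x) ∪ H.neighborFinset v) (fun w hw => by
        simp only [Finset.mem_filter, SimpleGraph.deleteEdges_adj] at hw
        rw [Finset.mem_union, Finset.mem_filter, SimpleGraph.mem_neighborFinset, hH,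
          SimpleGraph.fromEdgeSet_adj]
        by_cases hadj : G.Adj v w
        · exact Or.inr ⟨by_contra fun hn => hw.2.2 ⟨hadj, hn⟩, hw.2.1.symm⟩
        · exact Or.inl ⟨Finset.mem_univ _, hadj⟩)
    have h3 := Finset.card_union_le (Finset.univ.filter fun x => ¬ G.Adj v x)
      (H.neighborFinset v)
    have h4 := hdeg v
    rw [SimpleGraph.card_neighborFinset_eq_degree] at h3
    omega
  have hsum := H.sum_degrees_eq_twice_card_edges
  have hE : ∀ h : Fintype H.edgeSet, (@SimpleGraph.edgeFinset V H h).card ≤ R.card := by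
    intro _
    refine Finset.card_le_card fun e he => ?_
    rw [SimpleGraph.mem_edgeFinset, hH, SimpleGraph.edgeSet_fromEdgeSet] at he
    exact Finset.mem_coe.1 he.1
  have h5 : B.card * (m + 1) ≤ ∑ v, H.degree v :=
    calc B.card * (m + 1) = ∑ _v ∈ B, (m + 1) := by rw [Finset.sum_const, smul_eq_mul]
      _ ≤ ∑ v ∈ B, H.degree v := Finset.sum_le_sum hHdeg
      _ ≤ _ := Finset.sum_le_sum_of_subset (Finset.subset_univ _)
  have h6 : (2 * m + 2) * (m + 1) ≤ B.card * (m + 1) := Nat.mul_le_mul_right _ hBc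
  rw [hsum] at h5
  have h7 := h6.trans (h5.trans (Nat.mul_le_mul_left 2 (hE _)))
  nlinarith

/-! ### Assembling the tiling -/

theorem lemma3p1 {V : Type*} [Fintype V] [DecidableEq V]
    (k r : ℕ) (hk : 3 ≤ k) (hr : 1 ≤ r)
    (G : SimpleGraph V) [DecidableRel G.Adj]
    (S T : Finset V) (hdisj : Disjoint S T) (hunion : S ∪ T = Finset.univ)
    (hT : 5 * (k : ℝ) ^ 2 * Real.sqrt (r : ℝ) ≤ (T.card : ℝ))
    (hdeg : ∀ v : V, (Fintype.card V : ℝ) - (k : ℝ) * Real.sqrt (r : ℝ) ≤ (G.degree v : ℝ))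
    (R : Finset (Sym2 V))
    (hRG : ∀ e ∈ R, e ∈ G.edgeSet) (hRS : ∀ e ∈ R, ∀ v ∈ e, v ∈ S)
    (hRcard : R.card ≤ k ^ 2 * r) :
    ∃ F : Finset (Finset V),
      (∀ C ∈ F, (G.deleteEdges (R : Set (Sym2 V))).IsNClique k C) ∧
      (∀ C ∈ F, ∀ D ∈ F, C ≠ D → Disjoint C D) ∧
      (Finset.univ \ F.biUnion id) ⊆ T ∧
      (Finset.univ \ F.biUnion id).card ≤ k - 1 := by

  classical
  set d : ℝ := (k : ℝ) * Real.sqrt (r : ℝ) with hd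
  have hd0 : 0 ≤ d := by positivity
  have hkR : (3 : ℝ) ≤ k := by exact_mod_cast hk
  have hd1 : 1 ≤ d := by
    have : 1 ≤ Real.sqrt (r : ℝ) := Real.one_le_sqrt.2 (by exact_mod_cast hr)
    nlinarith
  set m := ⌊d⌋₊ with hmdef
  have hmd : (m : ℝ) ≤ d := Nat.floor_le hd0
  have hm : 1 ≤ m := Nat.le_floor (by simpa using hd1)
  have hR : R.card < (m + 1) ^ 2 := by
    refine hRcard.trans_lt ?_
    have h1 : d ^ 2 = (k : ℝ) ^ 2 * r := by
      rw [hd, mul_pow, Real.sq_sqrt (Nat.cast_nonneg r)]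
    have h2 : d ^ 2 < ((m : ℝ) + 1) ^ 2 := pow_lt_pow_left₀ (Nat.lt_floor_add_one d) hd0 two_ne_zero
    rw [h1] at h2
    exact_mod_cast h2
  have hTm : 5 * k * m ≤ T.card := by
    have h1 : 5 * (k : ℝ) * m ≤ T.card := by
      refine le_trans ?_ hT
      have : 5 * (k : ℝ) ^ 2 * Real.sqrt (r : ℝ) = 5 * (k : ℝ) * d := by rw [hd]; ring
      rw [this]
      gcongr
    exact_mod_cast h1
  have hnon : ∀ v, (Finset.univ.filter fun x => ¬ G.Adj v x).card ≤ m := by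
    intro v
    refine Nat.le_floor ?_
    have h1 : (Finset.univ.filter fun x => G.Adj v x).card
        + (Finset.univ.filter fun x => ¬ G.Adj v x).card = Fintype.card V :=
      Finset.card_filter_add_card_filter_not _
    have h2 : (Finset.univ.filter fun x => G.Adj v x).card = G.degree v := by
      rw [← G.card_neighborFinset_eq_degree, G.neighborFinset_eq_filter]
    rw [h2] at h1
    have h3 := hdeg v
    have h4 : (G.degree v : ℝ) + ((Finset.univ.filter fun x => ¬ G.Adj v x).card : ℝ)
        = Fintype.card V := by exact_mod_cast h1
    linarith
  set G' := G.deleteEdges (R : Set (Sym2 V)) with hG'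
  have hnonT : ∀ U ⊆ T, ∀ v, (U.filter fun x => ¬ G'.Adj v x).card ≤ m := by
    intro U hU v
    refine (Finset.card_le_card fun x hx => ?_).trans (hnon v)
    rw [Finset.mem_filter] at hx ⊢
    refine ⟨Finset.mem_univ _, fun hadj => hx.2 ?_⟩
    rw [hG', SimpleGraph.deleteEdges_adj]
    refine ⟨hadj, fun he => ?_⟩
    exact Finset.disjoint_left.1 hdisj (hRS _ he x (Sym2.mem_mk_right v x)) (hU hx.1)
  obtain ⟨f, hf, hfc⟩ := exists_cliqueColoring (G := G') (D := 2 * m + 1) S fun B _ hB => by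
    convert exists_card_nonadj_deleteEdges_lt (G := G) (m := m) (fun v => by convert hnon v) R hR B hB
  obtain ⟨j, rfl⟩ : ∃ j, k = j + 1 := ⟨k - 1, by omega⟩
  have hjm : j ≤ j * m := Nat.le_mul_of_pos_right _ hm
  have e1 : 5 * (j + 1) * m = 5 * (j * m) + 5 * m := by ring
  have e2 : (2 * m + 1) * j = 2 * (j * m) + j := by ring
  obtain ⟨E, hE, hEc, htE⟩ := exists_tileable_of_coloring (k := j + 1) (m := m) (by omega)
    (fun v => by convert hnonT T subset_rfl v) f (2 * m + 1) S
    (by rw [Nat.add_sub_cancel, e2]; omega) hdisj hf hfc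
  rw [Nat.add_sub_cancel, e2] at hEc
  have hcard := Finset.card_sdiff_add_card_eq_card hE
  set q := (T \ E).card / (j + 1) with hqdef
  -- With `k = j + 1`, at least `5(jm + m) - (2jm + j) ≥ 2m(j + 1)` vertices remain, because `j ≤
  -- jm`.
  have hq : 2 * m ≤ q := by
    rw [hqdef, Nat.le_div_iff_mul_le (by omega)]
    have : 2 * m * (j + 1) = 2 * (j * m) + 2 * m := by ring
    omega
  have hdiv : q * (j + 1) + (T \ E).card % (j + 1) = (T \ E).card := Nat.div_add_mod' _ _
  have hmod : (T \ E).card % (j + 1) < j + 1 := Nat.mod_lt _ (by omega)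
  obtain ⟨U, hU, hUc⟩ := Finset.exists_subset_card_eq (s := T \ E) (n := q * (j + 1)) (by omega)
  have htU : CliqueTileable G' (j + 1) U :=
    tileable_of_card_eq hm hq hUc fun v => by
      convert hnonT U (hU.trans Finset.sdiff_subset) v
  obtain ⟨F, hF, hFd, hFU⟩ := htE.union htU (by
    rw [Finset.disjoint_union_left]
    exact ⟨hdisj.mono_right (hU.trans Finset.sdiff_subset), Finset.disjoint_sdiff.mono_right hU⟩)
  have hsub : Finset.univ \ F.biUnion id ⊆ (T \ E) \ U := by
    intro x hx
    rw [hFU] at hx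
    have := Finset.mem_univ x
    rw [← hunion] at this
    simp only [Finset.mem_sdiff, Finset.mem_union] at hx this ⊢
    tauto
  refine ⟨F, hF, hFd, hsub.trans (Finset.sdiff_subset.trans Finset.sdiff_subset), ?_⟩
  have h1 := Finset.card_le_card hsub
  have h2 := Finset.card_sdiff_add_card_eq_card hU
  omega
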